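/- A cellular automaton (CA) $F=(d,S,N,f)$ consists of a dimension $d\in\mathbb{N}$, a finite set of states $S$, a finite neighborhood $N\subset\mathbb{Z}^d$ and a local rule $f:S^N\to S$. Its global map $F:S^{\mathbb{Z}^d}\to S^{\mathbb{Z}^d}$ is given by $F(c)_i=f\big((c_{i+n})_{n\in N}\big)$. A vector $p\in\mathbb{N}^d$ with positive entries is a period of a configuration $c\in S^{\mathbb{Z}^d}$ if $c_{i+p_je_j}=c_i$ for all $i\in\mathbb{Z}^d$ and $1\le j\le d$, where $e_j$ is the $j$-th unit vector. A CA with $S\subset\mathbb{Z}$ is number-conserving if $$\sum_{0\le k_j<p_j\ (1\le j\le d)} c_k=\sum_{0\le k_j<p_j\ (1\le j\le d)} F(c)_k$$ for every periodic configuration $c$ and every period $p$ of $c$. For an injective map $\varphi:S\to\mathbb{Z}$ (a relabeling), the relabeled CA has the set of states $\varphi(S)\subset\mathbb{Z}$, the same neighborhood, and the local rule $x\mapsto\varphi(f(\varphi^{-1}\circ x))$. Theorem. There is an algorithm (a total computable function) that, given any CA $F=(d,S,N,f)$ as finite data (the dimension, the number of states, a list of the vectors of $N$ and the table of $f$, for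 some numbering of the states), decides whether there is an injective relabeling $\varphi:S\to\mathbb{Z}$ that makes $F$ number-conserving, and that outputs such a $\varphi$, as the list of its values in the order of the numbering of the states, if one exists. -/

import Mathlib

/-- A `d`-dimensional cellular automaton with set of states `S`: a finite neighborhood
`N ⊂ ℤ^d` and a local rule `f : S^N → S`. Finiteness of `S` is supplied by the listings
`Fin q ≃ S` wherever automata are quantified over. -/
structure CellularAutomaton (d : ℕ) (S : Type*) where
  N : Finset (Fin d → ℤ)
  f : (N → S) → S

namespace CellularAutomaton

/-- The global map `F : S^(ℤ^d) → S^(ℤ^d)`, `F(c)_i = f(c|_(i+N))`. -/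
def globalMap {d : ℕ} {S : Type*} (F : CellularAutomaton d S)
    (c : (Fin d → ℤ) → S) : (Fin d → ℤ) → S :=
  fun i => F.f (fun n => c (i + n.1))

/-- `p ∈ ℕ^d`, all of whose entries are positive, is a (spatial) period of the configuration
`c`: `c` is unchanged by a translation by `p j` along the `j`-th axis, for every `j`. -/
def IsPeriod {d : ℕ} {S : Type*} (c : (Fin d → ℤ) → S) (p : Fin d → ℕ) : Prop :=
  (∀ j, 0 < p j) ∧ ∀ i j, c (i + Pi.single j (p j : ℤ)) = c i

/-- The set of cells `{0, …, p_1 - 1} × ⋯ × {0, …, p_d - 1}` of one period. -/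
noncomputable def periodBox {d : ℕ} (p : Fin d → ℕ) : Finset (Fin d → ℤ) :=
  Fintype.piFinset (fun j => Finset.Ico (0 : ℤ) (p j : ℤ))

/-- A cellular automaton whose states are integers is number-conserving if, for every
periodic configuration, the sum of the states over a period is preserved by the global map. -/
def NumberConserving {d : ℕ} {T : Set ℤ} (F : CellularAutomaton d T) : Prop :=
  ∀ (c : (Fin d → ℤ) → T) (p : Fin d → ℕ), IsPeriod c p →
    ∑ k ∈ periodBox p, (c k : ℤ) = ∑ k ∈ periodBox p, (F.globalMap c k : ℤ)

/-- The automaton `F` redefined with set of states `φ(S) ⊂ ℤ`, for an injective `φ : S → ℤ`. -/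
noncomputable def relabel {d : ℕ} {S : Type*} (F : CellularAutomaton d S)
    (φ : S → ℤ) (hφ : Function.Injective φ) : CellularAutomaton d (Set.range φ) where
  N := F.N
  f := fun x => Equiv.ofInjective φ hφ (F.f (fun n => (Equiv.ofInjective φ hφ).symm (x n)))

/-- The finite data by which an automaton is handed to an algorithm: the dimension, the number
of states, the list of the neighborhood vectors (each one as the list of its coordinates), and
the table of the local rule. -/
abbrev Code : Type := ℕ × ℕ × List (List ℤ) × List ℕ

/-- The code of `F` for a listing `e` of its `q` states and a listing `ν` of its `m` neighborhood
vectors. The rule table has length `q ^ m`. Its entry number `∑ i, w i * q ^ i`, where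
`w : Fin m → Fin q`, is the number of the state `f(x)`, where `x` is the pattern that has
state number `w i` at the neighborhood vector number `i`. -/
def code {d : ℕ} {S : Type*} {q m : ℕ} (F : CellularAutomaton d S)
    (e : Fin q ≃ S) (ν : Fin m ≃ F.N) : Code :=
  (d, q, List.ofFn (fun i : Fin m => List.ofFn (ν i).1),
    List.ofFn (fun k : Fin (q ^ m) =>
      ((e.symm (F.f (fun n => e (finFunctionFinEquiv.symm k (ν.symm n)))) : Fin q) : ℕ)))

end CellularAutomaton

/-! Number conservation is a family of linear equations in the values of `φ`, one for each periodic
configuration; the point is to reduce it to a finite, computable family. Call a finite quotient of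
`ℤ^d` faithful if it is injective on the window of differences of `N ∪ {0}`. On a faithful quotient,
changing one cell changes the total defect by `updateDefect`, which depends only on the pattern in
the window and not on the quotient. Hence conservation on one faithful quotient makes every
`updateDefect` vanish. By `Conserves.transfer` this gives conservation on every quotient `G'`: on
the faithful product `G' × G` the total defect is then constant, and it is zero on a constant
configuration. The tori of all periods can thus be replaced by the single group `ZMod (B ^ d)`, with
`B` read off the neighborhood.

What remains is a finite homogeneous integer system whose coefficients count, for each state, its
gain in one step. An injective solution exists if and only if no `e_i - e_j` lies in the rational
row space (`exists_isInjectiveSolution_or_isObstruction`). Both alternatives have integer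
certificates that can be checked primitive recursively, so a search for either one terminates. -/

/-! ### Conservation on finite groups -/

namespace GroupAutomaton

open Finset

variable {A S G : Type*} [AddCommGroup A] [AddCommGroup G] [Fintype G]

/-- Conservation of `φ` by the automaton with neighborhood `N` and local rule `f` on the
configurations indexed by the finite group `G`, on which `A` acts through `π`. -/
def Conserves (N : Finset A) (f : (N → S) → S) (φ : S → ℤ) (π : A →+ G) : Prop :=
  ∀ x : G → S, ∑ g, φ (f fun n => x (g + π n)) = ∑ g, φ (x g)

/-- The change of `φ` at the origin in one step, on the pattern `u`. -/
def localDefect (N : Finset A) (f : (N → S) → S) (φ : S → ℤ) (u : A → S) : ℤ :=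
  φ (f fun n => u n) - φ (u 0)

/-- The change of `φ` in one step, summed over `G`. -/
def totalDefect (N : Finset A) (f : (N → S) → S) (φ : S → ℤ) (π : A →+ G) (x : G → S) : ℤ :=
  ∑ g, localDefect N f φ fun v => x (g + π v)

lemma conserves_iff_totalDefect {N : Finset A} {f : (N → S) → S} {φ : S → ℤ} {π : A →+ G} :
    Conserves N f φ π ↔ ∀ x, totalDefect N f φ π x = 0 := by
  simp [Conserves, totalDefect, localDefect, sub_eq_zero]

/-- The finite window of differences of elements of `N ∪ {0}`. -/
def window [DecidableEq A] (N : Finset A) : Set A :=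
  {w | ∃ u ∈ insert 0 N, ∃ v ∈ insert 0 N, w = u - v}

lemma localDefect_congr [DecidableEq A] {N : Finset A} {f : (N → S) → S} {φ : S → ℤ}
    {u u' : A → S} (h : ∀ v ∈ insert 0 N, u v = u' v) :
    localDefect N f φ u = localDefect N f φ u' := by
  unfold localDefect
  rw [h 0 (mem_insert_self _ _)]
  congr 3
  funext n
  exact h n (mem_insert_of_mem n.2)

/-- The change of the total defect caused by setting the origin of the pattern `u` to `a`. -/
def updateDefect [DecidableEq A] (N : Finset A) (f : (N → S) → S) (φ : S → ℤ) (u : A → S)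
    (a : S) : ℤ :=
  ∑ n ∈ insert 0 N, (localDefect N f φ (fun v => Function.update u 0 a (v - n)) -
    localDefect N f φ (fun v => u (v - n)))

/-- The defects summed here read `u` only at differences `v - n` with `v` and `n` in `N ∪ {0}`. -/
lemma updateDefect_congr [DecidableEq A] {N : Finset A} {f : (N → S) → S} {φ : S → ℤ}
    {u u' : A → S} (a : S) (h : ∀ w ∈ window N, u w = u' w) :
    updateDefect N f φ u a = updateDefect N f φ u' a := by
  refine sum_congr rfl fun n hn => ?_
  have h' : ∀ v ∈ insert 0 N, u (v - n) = u' (v - n) := fun v hv => h _ ⟨v, hv, n, hn, rfl⟩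
  congr 1
  · refine localDefect_congr fun v hv => ?_
    simp only [Function.update_apply, h' v hv]
  · exact localDefect_congr h'

/-- Only the cells `z - π n` with `n ∈ N ∪ {0}` see the cell `z`. Faithfulness on the window keeps
these cells distinct and lets each of them see `z` at one vector only, so the computation is the
same as in `A`. -/
lemma totalDefect_update_sub [DecidableEq A] [DecidableEq G] {N : Finset A} {f : (N → S) → S}
    {φ : S → ℤ} {π : A →+ G} (hπ : Set.InjOn π (window N)) (x : G → S) (z : G) (a : S) :
    totalDefect N f φ π (Function.update x z a) - totalDefect N f φ π x =
      updateDefect N f φ (fun w => x (z + π w)) a := by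
  have hmem : ∀ n ∈ insert 0 N, n ∈ window N := fun n hn =>
    ⟨n, hn, 0, mem_insert_self _ _, (sub_zero n).symm⟩
  have hinj : Set.InjOn (fun n => z - π n) (insert 0 N : Finset A) := by
    intro n hn n' hn' h
    exact hπ (hmem n hn) (hmem n' hn') (sub_right_injective h)
  unfold totalDefect updateDefect
  rw [← sum_sub_distrib, ← sum_subset (subset_univ ((insert 0 N).image fun n => z - π n)),
    sum_image hinj]
  · refine sum_congr rfl fun n hn => ?_
    congr 1
    · refine localDefect_congr fun v hv => ?_
      have h0 : z - π n + π v = z ↔ v - n = 0 := by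
        rw [show z - π n + π v = z + π (v - n) by rw [map_sub]; abel, add_eq_left,
          ← map_zero π]
        exact hπ.eq_iff ⟨v, hv, n, hn, rfl⟩ (hmem 0 (mem_insert_self _ _))
      simp only [Function.update_apply, h0]
      split_ifs
      · rfl
      · rw [map_sub]; congr 1; abel
    · refine localDefect_congr fun v _ => ?_
      simp only [map_sub]; congr 1; abel
  · intro g _ hg
    rw [sub_eq_zero]
    refine localDefect_congr fun v hv => Function.update_of_ne ?_ _ _
    rintro rfl
    exact hg (mem_image.2 ⟨v, hv, by abel⟩)

lemma updateDefect_eq_zero [DecidableEq A] {N : Finset A} {f : (N → S) → S}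
    {φ : S → ℤ} {π : A →+ G} (hπ : Set.InjOn π (window N)) (h : Conserves N f φ π)
    (u : A → S) (a : S) : updateDefect N f φ u a = 0 := by
  classical
  rw [conserves_iff_totalDefect] at h
  -- The pattern `u` on the window is carried to `G` by an inverse of `π` there.
  have key := totalDefect_update_sub hπ (f := f) (φ := φ)
    (fun g => u (Function.invFunOn π (window N) g)) 0 a
  rw [h, h, sub_zero] at key
  rw [key]
  refine updateDefect_congr a fun w hw => ?_
  simp only [zero_add]
  rw [hπ.leftInvOn_invFunOn hw]

/-- The configuration `y` is turned into `x` one cell at a time. -/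
lemma totalDefect_eq_of_updateDefect [DecidableEq A] {N : Finset A} {f : (N → S) → S}
    {φ : S → ℤ} {π : A →+ G} (hπ : Set.InjOn π (window N))
    (h : ∀ u a, updateDefect N f φ u a = 0) (x y : G → S) :
    totalDefect N f φ π x = totalDefect N f φ π y := by
  classical
  have key : ∀ s : Finset G,
      totalDefect N f φ π (s.piecewise x y) = totalDefect N f φ π y := by
    intro s
    induction s using Finset.induction_on with
    | empty => simp
    | insert z s _ ih =>
      rw [piecewise_insert, ← ih, ← sub_eq_zero, totalDefect_update_sub hπ, h]
  simpa using key univ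

/-- Conservation on one finite quotient that is faithful on the window of the neighborhood
entails conservation on all finite groups. -/
theorem Conserves.transfer [DecidableEq A] {N : Finset A} {f : (N → S) → S} {φ : S → ℤ}
    {π : A →+ G} (hπ : Set.InjOn π (window N)) (h : Conserves N f φ π)
    {G' : Type*} [AddCommGroup G'] [Fintype G'] (π' : A →+ G') : Conserves N f φ π' := by
  have hD := updateDefect_eq_zero hπ h
  rw [conserves_iff_totalDefect] at h ⊢
  intro x
  -- The second factor alone makes the product faithful, so nothing is required of `π'`.
  have hprod : Set.InjOn (π'.prod π) (window N) := fun v hv w hw hvw =>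
    hπ hv hw (congrArg Prod.snd hvw)
  have hconst := totalDefect_eq_of_updateDefect hprod hD (fun g => x g.1) (fun _ => x 0)
  -- A configuration that ignores the second coordinate repeats the sum over `G'` once for each
  -- element of `G`.
  have hl : totalDefect N f φ (π'.prod π) (fun g => x g.1) =
      Fintype.card G * totalDefect N f φ π' x := by
    simp [totalDefect, Fintype.sum_prod_type, mul_sum]
  have h0 : localDefect N f φ (fun _ => x 0) = 0 := by
    have := h fun _ => x 0
    simpa [totalDefect] using this
  have hr : totalDefect N f φ (π'.prod π) (fun _ => x 0) = 0 := by
    simp [totalDefect, h0]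
  rw [hl, hr] at hconst
  simpa using hconst

end GroupAutomaton

/-! ### Periodic configurations -/

namespace CellularAutomaton

open Finset GroupAutomaton

variable {d : ℕ} {S : Type*}

/-- The reduction of cells modulo the period `p`. -/
def toTorus (p : Fin d → ℕ) : (Fin d → ℤ) →+ ((j : Fin d) → ZMod (p j)) where
  toFun v j := (v j : ZMod (p j))
  map_zero' := by ext; simp
  map_add' v w := by ext; simp

lemma isPeriod_comp_toTorus {p : Fin d → ℕ} (hp : ∀ j, 0 < p j)
    (x : ((j : Fin d) → ZMod (p j)) → S) : IsPeriod (fun v => x (toTorus p v)) p := by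
  refine ⟨hp, fun i j => ?_⟩
  have : toTorus p (Pi.single j (p j : ℤ)) = 0 := by
    ext k
    by_cases h : k = j
    · subst h; simp [toTorus]
    · simp [toTorus, h]
  simp only [map_add, this, add_zero]

lemma IsPeriod.add_mem {c : (Fin d → ℤ) → S} {p : Fin d → ℕ} (h : IsPeriod c p)
    (m : Fin d → ℤ) (i : Fin d → ℤ) : c (i + fun j => m j * p j) = c i := by
  let P : AddSubgroup (Fin d → ℤ) :=
    { carrier := {w | ∀ i, c (i + w) = c i}
      zero_mem' := fun i => by simp
      add_mem' := fun {v w} hv hw i => by rw [← add_assoc, hw, hv]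
      neg_mem' := fun {v} hv i => by rw [← hv (i + -v), neg_add_cancel_right] }
  have hm : (fun j => m j * p j) = ∑ j, m j • (Pi.single j (p j : ℤ) : Fin d → ℤ) := by
    ext k
    simp [Finset.sum_apply, Pi.single_apply]
  have : (fun j => m j * p j) ∈ P := by
    rw [hm]
    exact P.sum_mem fun j _ => P.zsmul_mem (fun i => h.2 i j) _
  exact this i

lemma IsPeriod.eq_of_toTorus_eq {c : (Fin d → ℤ) → S} {p : Fin d → ℕ} (h : IsPeriod c p)
    {v w : Fin d → ℤ} (hvw : toTorus p v = toTorus p w) : c v = c w := by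
  have : ∀ j, ∃ m : ℤ, v j = w j + m * p j := fun j => by
    have := congrFun hvw j
    simp only [toTorus, AddMonoidHom.coe_mk, ZeroHom.coe_mk] at this
    obtain ⟨m, hm⟩ := ((ZMod.intCast_eq_intCast_iff_dvd_sub _ _ _).1 this.symm)
    exact ⟨m, by linarith⟩
  choose m hm using this
  rw [show v = w + fun j => m j * p j from funext hm, h.add_mem]

lemma sum_periodBox_toTorus (p : Fin d → ℕ) [∀ j, NeZero (p j)]
    (y : ((j : Fin d) → ZMod (p j)) → ℤ) :
    ∑ k ∈ periodBox p, y (toTorus p k) = ∑ g, y g := by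
  refine sum_bij' (fun k _ => toTorus p k) (fun g _ j => ((g j).val : ℤ)) ?_ ?_ ?_ ?_ ?_
  · simp
  · intro g _
    simp only [periodBox, Fintype.mem_piFinset, mem_Ico]
    exact fun j => ⟨Int.natCast_nonneg _, by exact_mod_cast ZMod.val_lt _⟩
  · intro k hk
    ext j
    simp only [periodBox, Fintype.mem_piFinset, mem_Ico] at hk
    simp only [toTorus, AddMonoidHom.coe_mk, ZeroHom.coe_mk, ZMod.val_intCast]
    exact Int.emod_eq_of_lt (hk j).1 (hk j).2
  · intro g _
    ext j
    simp [toTorus]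
  · simp

lemma numberConserving_relabel_iff (F : CellularAutomaton d S) (φ : S → ℤ)
    (hφ : Function.Injective φ) :
    (F.relabel φ hφ).NumberConserving ↔ ∀ (c : (Fin d → ℤ) → S) (p : Fin d → ℕ), IsPeriod c p →
      ∑ k ∈ periodBox p, φ (c k) = ∑ k ∈ periodBox p, φ (F.globalMap c k) := by
  let E := Equiv.ofInjective φ hφ
  constructor
  · intro h c p hc
    have := h (fun k => E (c k)) p ⟨hc.1, fun i j => congrArg E (hc.2 i j)⟩
    simpa [globalMap, relabel, E] using this
  · intro h c p hc
    have := h (fun k => E.symm (c k)) p ⟨hc.1, fun i j => congrArg E.symm (hc.2 i j)⟩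
    have hE : ∀ s, φ (E.symm s) = s := fun s => congrArg Subtype.val (E.apply_symm_apply s)
    simp only [hE] at this
    simpa [globalMap, relabel, E] using this

/-- Configurations of period `p` are exactly the pullbacks of configurations on the torus. -/
lemma numberConserving_iff_conserves (F : CellularAutomaton d S) (φ : S → ℤ)
    (hφ : Function.Injective φ) :
    (F.relabel φ hφ).NumberConserving ↔ ∀ (p : Fin d → ℕ) [∀ j, NeZero (p j)],
      Conserves F.N F.f φ (toTorus p) := by
  rw [numberConserving_relabel_iff]
  constructor
  · intro h p _ x
    have := h _ p (isPeriod_comp_toTorus (fun j => Nat.pos_of_neZero (p j)) x)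
    simp only [globalMap, map_add] at this
    rw [sum_periodBox_toTorus p (fun g => φ (x g)),
      sum_periodBox_toTorus p (fun g => φ (F.f fun n => x (g + toTorus p n)))] at this
    exact this.symm
  · intro h c p hc
    have : ∀ j, NeZero (p j) := fun j => ⟨(hc.1 j).ne'⟩
    let x : ((j : Fin d) → ZMod (p j)) → S := fun g => c fun j => ((g j).val : ℤ)
    have hx : ∀ v, c v = x (toTorus p v) := fun v => hc.eq_of_toTorus_eq <| by
      ext j
      simp [toTorus]
    have := h p x
    rw [← sum_periodBox_toTorus p (fun g => φ (x g)),
      ← sum_periodBox_toTorus p (fun g => φ (F.f fun n => x (g + toTorus p n)))] at this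
    simp only [← map_add, ← hx] at this
    exact this.symm

/-! ### A cyclic quotient -/

/-- The cells of `ℤ ^ d` numbered, modulo `B ^ d`, as integers written in base `B`. -/
def toCyclic (B : ℕ) : (Fin d → ℤ) →+ ZMod (B ^ d) where
  toFun v := ((∑ j, v j * (B : ℤ) ^ (j : ℕ) : ℤ) : ZMod (B ^ d))
  map_zero' := by simp
  map_add' v w := by simp [add_mul, sum_add_distrib]

/-- Modulo `B` only the digit `w 0` survives, and it is too small to be a nonzero multiple of `B`.
Dividing by `B` leaves the same claim with one digit fewer. -/
lemma eq_zero_of_pow_dvd_sum {B : ℤ} : ∀ {d : ℕ} (w : Fin d → ℤ), (∀ j, |w j| < B) →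
    B ^ d ∣ ∑ j, w j * B ^ (j : ℕ) → w = 0
  | 0, _, _, _ => Subsingleton.elim _ _
  | d + 1, w, hw, h => by
    have hB : 0 < B := (abs_nonneg _).trans_lt (hw 0)
    have hs : ∑ j, w j * B ^ (j : ℕ) = w 0 + B * ∑ j : Fin d, w j.succ * B ^ (j : ℕ) := by
      rw [Fin.sum_univ_succ, mul_sum]
      simp only [Fin.val_zero, pow_zero, mul_one, Fin.val_succ, pow_succ]
      congr 1
      exact sum_congr rfl fun _ _ => by ring
    rw [hs] at h
    have h0 : w 0 = 0 := by
      refine Int.eq_zero_of_abs_lt_dvd ?_ (hw 0)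
      exact (Int.dvd_add_left (dvd_mul_right B _)).1
        ((dvd_pow_self B d.succ_ne_zero).trans h)
    rw [h0, zero_add, pow_succ', mul_dvd_mul_iff_left hB.ne'] at h
    have := eq_zero_of_pow_dvd_sum (fun j => w j.succ) (fun j => hw _) h
    funext j
    refine Fin.cases h0 (fun i => congrFun this i) j

lemma abs_le_of_mem_window {N : Finset (Fin d → ℤ)} {R : ℤ} (hR : 0 ≤ R)
    (hN : ∀ n ∈ N, ∀ j, |n j| ≤ R) {w : Fin d → ℤ} (hw : w ∈ window N) (j : Fin d) :
    |w j| ≤ 2 * R := by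
  have h : ∀ n ∈ insert 0 N, |n j| ≤ R := by
    intro n hn
    rcases mem_insert.1 hn with rfl | hn
    · simpa using hR
    · exact hN n hn j
  obtain ⟨u, hu, v, hv, rfl⟩ := hw
  have := abs_sub (u j) (v j)
  have := h u hu
  have := h v hv
  simp only [Pi.sub_apply]
  linarith

/-- Window vectors have entries of size at most `2 * R`, so their differences have digits of size at
most `4 * R < B`. -/
lemma injOn_toCyclic {N : Finset (Fin d → ℤ)} {R : ℤ} (hR : 0 ≤ R)
    (hN : ∀ n ∈ N, ∀ j, |n j| ≤ R) {B : ℕ} (hB : 4 * R < B) :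
    Set.InjOn (toCyclic B) (window N) := by
  intro v hv w hw h
  rw [← sub_eq_zero]
  refine eq_zero_of_pow_dvd_sum (B := B) _ (fun j => ?_) ?_
  · have := abs_sub (v j) (w j)
    have := abs_le_of_mem_window hR hN hv j
    have := abs_le_of_mem_window hR hN hw j
    simp only [Pi.sub_apply]
    linarith
  · rw [← sub_eq_zero, ← map_sub] at h
    simp only [toCyclic, AddMonoidHom.coe_mk, ZeroHom.coe_mk, ZMod.intCast_zmod_eq_zero_iff_dvd]
      at h
    exact_mod_cast h

lemma injOn_toTorus {N : Finset (Fin d → ℤ)} {R : ℤ} (hR : 0 ≤ R)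
    (hN : ∀ n ∈ N, ∀ j, |n j| ≤ R) {B : ℕ} (hB : 4 * R < B) :
    Set.InjOn (toTorus fun _ : Fin d => B) (window N) := by
  intro v hv w hw h
  funext j
  have h := congrFun h j
  simp only [toTorus, AddMonoidHom.coe_mk, ZeroHom.coe_mk] at h
  rw [eq_comm, ZMod.intCast_eq_intCast_iff_dvd_sub] at h
  have := abs_sub (v j) (w j)
  have := abs_le_of_mem_window hR hN hv j
  have := abs_le_of_mem_window hR hN hw j
  exact sub_eq_zero.1 (Int.eq_zero_of_abs_lt_dvd h (by linarith))

/-- A relabeled automaton is number-conserving if and only if the numbering of the states is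
conserved on one large enough finite cyclic group. -/
theorem numberConserving_iff_conserves_toCyclic (F : CellularAutomaton d S) (φ : S → ℤ)
    (hφ : Function.Injective φ) {R : ℤ} (hR : 0 ≤ R) (hN : ∀ n ∈ F.N, ∀ j, |n j| ≤ R) {B : ℕ}
    [NeZero B] (hB : 4 * R < B) :
    (F.relabel φ hφ).NumberConserving ↔ Conserves F.N F.f φ (toCyclic B) := by
  rw [numberConserving_iff_conserves]
  exact ⟨fun h => (h fun _ => B).transfer (injOn_toTorus hR hN hB) _,
    fun h p _ => h.transfer (injOn_toCyclic hR hN hB) _⟩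

end CellularAutomaton

/-! ### Injective vectors in the kernel of an integer matrix -/

namespace IntMatrix

open Finset

/-- `w` has distinct entries and is in the kernel of the matrix `a` with `r` rows and `q`
columns. -/
def IsInjectiveSolution (r q : ℕ) (a : ℕ → ℕ → ℤ) (w : ℕ → ℤ) : Prop :=
  (∀ i < q, ∀ j < i, w i ≠ w j) ∧ ∀ k < r, ∑ s ∈ range q, a k s * w s = 0

/-- The entries of `w` express a multiple of some `e i - e j` by the rows of the matrix `a`. -/
def IsObstruction (r q : ℕ) (a : ℕ → ℕ → ℤ) (w : ℕ → ℤ) : Prop :=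
  w 0 ≠ 0 ∧ ∃ i < q, ∃ j < i, ∀ s < q,
    ∑ k ∈ range r, w (k + 1) * a k s = w 0 * ((if s = i then 1 else 0) - if s = j then 1 else 0)

/-- Pairing the combination of rows with a kernel vector `z` gives `w 0 * (z i - z j) = 0`. -/
lemma IsObstruction.not_isInjectiveSolution {r q : ℕ} {a : ℕ → ℕ → ℤ} {w : ℕ → ℤ}
    (h : IsObstruction r q a w) (z : ℕ → ℤ) : ¬ IsInjectiveSolution r q a z := by
  obtain ⟨h0, i, hi, j, hj, h⟩ := h
  rintro ⟨hinj, hz⟩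
  have h1 : ∑ s ∈ range q, (∑ k ∈ range r, w (k + 1) * a k s) * z s = 0 := by
    simp only [sum_mul]
    rw [sum_comm]
    refine sum_eq_zero fun k hk => ?_
    simp only [mul_assoc, ← mul_sum]
    rw [hz k (mem_range.1 hk), mul_zero]
  have h2 : ∑ s ∈ range q, (∑ k ∈ range r, w (k + 1) * a k s) * z s = w 0 * (z i - z j) := by
    rw [sum_congr rfl fun s hs => by rw [h s (mem_range.1 hs)]]
    simp only [mul_assoc, ← mul_sum, sub_mul, sum_sub_distrib, ite_mul, one_mul, zero_mul]
    simp [hi, hj.trans hi]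
  rw [h1] at h2
  rcases mul_eq_zero.1 h2.symm with h | h
  · exact h0 h
  · exact hinj i hi j hj (sub_eq_zero.1 h)

lemma exists_common_denominator (n : ℕ) (x : ℕ → ℚ) :
    ∃ (D : ℤ) (z : ℕ → ℤ), D ≠ 0 ∧ ∀ i < n, (z i : ℚ) = D * x i := by
  refine ⟨∏ i ∈ range n, ((x i).den : ℤ),
    fun i => (x i).num * ∏ k ∈ (range n).erase i, ((x k).den : ℤ),
    prod_ne_zero_iff.2 fun i _ => by exact_mod_cast (x i).den_nz, fun i hi => ?_⟩
  rw [← mul_prod_erase _ _ (mem_range.2 hi)]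
  push_cast
  have : ((x i).den : ℚ) * x i = (x i).num := Rat.den_mul_eq_num _
  rw [← this]
  ring

/-- Either there is an integer vector with distinct entries in the kernel of `a`, or there is an
obstruction. -/
theorem exists_isInjectiveSolution_or_isObstruction (r q : ℕ) (a : ℕ → ℕ → ℤ) :
    (∃ w, IsInjectiveSolution r q a w) ∨ ∃ w, IsObstruction r q a w := by
  let row : Fin r → Fin q → ℚ := fun k s => a k s
  let V : Submodule ℚ (Fin q → ℚ) := Submodule.span ℚ (Set.range row)
  let ι := {ij : Fin q × Fin q // ij.2 < ij.1}
  let v : ι → (Fin q → ℚ) ⧸ V := fun ij =>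
    V.mkQ (Pi.single ij.1.1 1 - Pi.single ij.1.2 1)
  by_cases hv : ∀ ij, v ij ≠ 0
  · left
    -- As `ℚ` is infinite, one functional is nonzero on finitely many given nonzero vectors. A
    -- functional on the quotient by the row space is a kernel vector; its entries are the values on
    -- the classes of the unit vectors.
    obtain ⟨f, hf⟩ := Module.exists_dual_forall_apply_ne_zero (K := ℚ) v hv
    let x : ℕ → ℚ := fun s => if h : s < q then f (V.mkQ (Pi.single ⟨s, h⟩ 1)) else 0
    obtain ⟨D, z, hD, hz⟩ := exists_common_denominator q x
    refine ⟨z, fun i hi j hj hij => ?_, fun k hk => ?_⟩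
    · apply hf ⟨(⟨i, hi⟩, ⟨j, hj.trans hi⟩), hj⟩
      have h1 : (z i : ℚ) = z j := by rw [hij]
      rw [hz i hi, hz j (hj.trans hi)] at h1
      have h2 := mul_left_cancel₀ (by exact_mod_cast hD) h1
      simp only [x, hi, hj.trans hi, dif_pos] at h2
      simp only [v, map_sub, h2, sub_self]
    · have hrow : f (V.mkQ (row ⟨k, hk⟩)) = 0 := by
        have : V.mkQ (row ⟨k, hk⟩) = 0 := by
          rw [Submodule.mkQ_apply, Submodule.Quotient.mk_eq_zero]
          exact Submodule.subset_span ⟨_, rfl⟩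
        rw [this, map_zero]
      have hsum : row ⟨k, hk⟩ = ∑ s : Fin q, (a k s : ℚ) • (Pi.single s 1 : Fin q → ℚ) := by
        ext t
        simp [row, Finset.sum_apply, Pi.single_apply]
      rw [hsum] at hrow
      simp only [map_sum, map_smul, smul_eq_mul] at hrow
      have : (∑ s ∈ range q, (a k s : ℚ) * z s) = 0 := by
        rw [sum_range, ← mul_zero (D : ℚ), ← hrow, mul_sum]
        refine sum_congr rfl fun s _ => ?_
        rw [hz s s.2]
        simp only [x, s.2, dif_pos, Fin.eta]
        ring
      exact_mod_cast this
  · right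
    push Not at hv
    obtain ⟨⟨⟨i, j⟩, hij⟩, h⟩ := hv
    simp only [v, Submodule.mkQ_apply, Submodule.Quotient.mk_eq_zero, V] at h
    obtain ⟨m, hm⟩ := (Submodule.mem_span_range_iff_exists_fun ℚ).1 h
    obtain ⟨D, z, hD, hz⟩ := exists_common_denominator r
      (fun k => if h : k < r then m ⟨k, h⟩ else 0)
    -- Entry `0` holds the common denominator, and entry `k + 1` the coefficient of row `k`.
    refine ⟨fun k => k.casesOn D z, hD, i, i.2, j, hij, fun s hs => ?_⟩
    have hms := congrFun hm ⟨s, hs⟩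
    simp only [Finset.sum_apply, Pi.smul_apply, smul_eq_mul, Pi.sub_apply, Pi.single_apply,
      row, Fin.ext_iff] at hms
    have : (∑ k ∈ range r, (z k : ℚ) * a k s) =
        D * ((if s = i then 1 else 0) - if s = j then 1 else 0) := by
      rw [← hms, sum_range, mul_sum]
      refine sum_congr rfl fun k _ => ?_
      rw [hz k k.2]
      simp only [k.2, dif_pos, Fin.eta]
      ring
    exact_mod_cast this

end IntMatrix

/-! ### Primitive recursion -/

namespace Primrec

open Finset

variable {α β : Type*} [Primcodable α] [Primcodable β]

lemma encode_int_natCast (n : ℕ) : Encodable.encode (n : ℤ) = 2 * n := rfl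

lemma encode_int_negSucc (n : ℕ) : Encodable.encode (Int.negSucc n) = 2 * n + 1 := rfl

lemma int_toNat : Primrec Int.toNat := by
  have h : Primrec fun z : ℤ => if Encodable.encode z % 2 = 0 then Encodable.encode z / 2 else 0 :=
    Primrec.ite (Primrec.eq.comp (nat_mod.comp Primrec.encode (const 2)) (const 0))
      (nat_div.comp Primrec.encode (const 2)) (const 0)
  refine h.of_eq fun z => ?_
  rcases z with n | n
  · rw [Int.ofNat_eq_natCast, encode_int_natCast]; simp
  · rw [encode_int_negSucc]; simp

lemma int_neg_toNat : Primrec fun z : ℤ => (-z).toNat := by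
  have h : Primrec fun z : ℤ =>
      if Encodable.encode z % 2 = 0 then 0 else (Encodable.encode z + 1) / 2 :=
    Primrec.ite (Primrec.eq.comp (nat_mod.comp Primrec.encode (const 2)) (const 0))
      (const 0) (nat_div.comp (succ.comp Primrec.encode) (const 2))
  refine h.of_eq fun z => ?_
  rcases z with n | n
  · rw [Int.ofNat_eq_natCast, encode_int_natCast]; simp
  · rw [encode_int_negSucc]
    simp [Int.neg_negSucc]
    omega

/-- Integer arithmetic is reduced to this map by `x = x.toNat - (-x).toNat`; the encoding sends `n`
to `2 * n` and `-(n + 1)` to `2 * n + 1`. -/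
lemma int_natCast_sub : Primrec₂ fun m n : ℕ => (m : ℤ) - n := by
  rw [← Primrec₂.encode_iff]
  have h : Primrec₂ fun m n : ℕ => if n ≤ m then 2 * (m - n) else 2 * (n - m - 1) + 1 :=
    Primrec.ite (nat_le.comp snd fst)
      (nat_mul.comp (const 2) (nat_sub.comp fst snd))
      (succ.comp (nat_mul.comp (const 2) (nat_sub.comp (nat_sub.comp snd fst) (const 1))))
  refine h.of_eq fun m n => ?_
  split_ifs with hmn
  · rw [← Int.ofNat_sub hmn, encode_int_natCast]
  · rw [show (m : ℤ) - n = Int.negSucc (n - m - 1) by omega, encode_int_negSucc]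

lemma int_natCast : Primrec fun n : ℕ => (n : ℤ) :=
  (int_natCast_sub.comp .id (const 0)).of_eq fun n => by simp

lemma int_add : Primrec₂ fun x y : ℤ => x + y :=
  (int_natCast_sub.comp (nat_add.comp (int_toNat.comp fst) (int_toNat.comp snd))
    (nat_add.comp (int_neg_toNat.comp fst) (int_neg_toNat.comp snd))).of_eq fun ⟨x, y⟩ => by
      push_cast
      have := Int.toNat_sub_toNat_neg x
      have := Int.toNat_sub_toNat_neg y
      linarith

lemma int_neg : Primrec fun x : ℤ => -x :=
  (int_natCast_sub.comp int_neg_toNat int_toNat).of_eq fun x => by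
    have := Int.toNat_sub_toNat_neg x
    linarith

lemma int_sub : Primrec₂ fun x y : ℤ => x - y :=
  (int_add.comp fst (int_neg.comp snd)).of_eq fun _ => (sub_eq_add_neg _ _).symm

lemma int_mul : Primrec₂ fun x y : ℤ => x * y :=
  (int_natCast_sub.comp
    (nat_add.comp (nat_mul.comp (int_toNat.comp fst) (int_toNat.comp snd))
      (nat_mul.comp (int_neg_toNat.comp fst) (int_neg_toNat.comp snd)))
    (nat_add.comp (nat_mul.comp (int_toNat.comp fst) (int_neg_toNat.comp snd))
      (nat_mul.comp (int_neg_toNat.comp fst) (int_toNat.comp snd)))).of_eq fun ⟨x, y⟩ => by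
      push_cast
      conv_rhs => rw [← Int.toNat_sub_toNat_neg x, ← Int.toNat_sub_toNat_neg y]
      ring

lemma int_natAbs : Primrec Int.natAbs :=
  (nat_add.comp int_toNat int_neg_toNat).of_eq fun x => by omega

lemma nat_pow : Primrec₂ fun m n : ℕ => m ^ n :=
  Primrec₂.unpaired'.1 Nat.Primrec.pow

lemma sum_range {M : Type*} [Primcodable M] [AddCommMonoid M]
    (hadd : Primrec₂ fun x y : M => x + y) {n : α → ℕ} {f : α → ℕ → M} (hn : Primrec n)
    (hf : Primrec₂ f) : Primrec fun a => ∑ i ∈ range (n a), f a i := by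
  refine (nat_rec' (h := fun a p => p.2 + f a p.1) hn (const 0) (hadd.comp (snd.comp snd)
    (hf.comp fst (fst.comp snd)))).of_eq fun a => ?_
  induction n a with
  | zero => simp
  | succ k ih => rw [Finset.sum_range_succ, ← ih]

lemma getD {d : β} {l : α → List β} {n : α → ℕ} (hl : Primrec l) (hn : Primrec n) :
    Primrec fun a => (l a).getD (n a) d :=
  (list_getD d).comp hl hn

end Primrec

namespace PrimrecPred

variable {α : Type*} [Primcodable α]

lemma forall_lt' {n : α → ℕ} {p : α → ℕ → Prop} (hn : Primrec n)
    (hp : PrimrecPred fun x : α × ℕ => p x.1 x.2) :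
    PrimrecPred fun a => ∀ i < n a, p a i :=
  ((hp.comp (Primrec.pair Primrec.snd Primrec.fst)).primrecRel.forall_mem_list.comp
    (Primrec.list_range.comp hn) Primrec.id).of_eq fun a => by simp

lemma exists_lt' {n : α → ℕ} {p : α → ℕ → Prop} (hn : Primrec n)
    (hp : PrimrecPred fun x : α × ℕ => p x.1 x.2) :
    PrimrecPred fun a => ∃ i < n a, p a i :=
  ((hp.comp (Primrec.pair Primrec.snd Primrec.fst)).primrecRel.exists_mem_list.comp
    (Primrec.list_range.comp hn) Primrec.id).of_eq fun a => by simp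

end PrimrecPred

/-- A search through `β` for an element with one of two primitive recursive properties, one of
which is always found, is computable. -/
theorem exists_computable_search {α β : Type*} [Primcodable α] [Denumerable β]
    {p r : α → β → Prop} (hp : PrimrecRel p) (hr : PrimrecRel r)
    (h : ∀ a, (∃ b, p a b) ∨ ∃ b, r a b) :
    ∃ f : α → Option β, Computable f ∧
      ∀ a, (f a = none → ∃ b, r a b) ∧ ∀ b, f a = some b → p a b := by
  classical
  -- The outer `none` continues the search; `some none` stops it with a witness for `r`.
  let t : α → ℕ → Option (Option β) := fun a n =>
    if p a (Denumerable.ofNat β n) then some (some (Denumerable.ofNat β n))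
    else if r a (Denumerable.ofNat β n) then some none else none
  have hof : Primrec fun x : α × ℕ => Denumerable.ofNat β x.2 :=
    (Primrec.ofNat β).comp Primrec.snd
  have ht : Primrec₂ t :=
    Primrec.ite (hp.comp Primrec.fst hof) (Primrec.option_some.comp (Primrec.option_some.comp hof))
      (Primrec.ite (hr.comp Primrec.fst hof) (Primrec.const _) (Primrec.const _))
  have hdom : ∀ a, (Nat.rfindOpt (t a)).Dom := by
    intro a
    rw [Nat.rfindOpt_dom]
    rcases h a with ⟨b, hb⟩ | ⟨b, hb⟩
    · exact ⟨Encodable.encode b, some b, by simp [t, hb]⟩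
    · by_cases hpb : p a b
      · exact ⟨Encodable.encode b, some b, by simp [t, hpb]⟩
      · exact ⟨Encodable.encode b, none, by simp [t, hb, hpb]⟩
  have hspec : ∀ a, ∃ n, (Nat.rfindOpt (t a)).get (hdom a) ∈ t a n := fun a =>
    Nat.rfindOpt_spec (Part.get_mem (hdom a))
  refine ⟨fun a => (Nat.rfindOpt (t a)).get (hdom a),
    (Partrec.rfindOpt ht.to_comp).of_eq fun a => (Part.some_get (hdom a)).symm, fun a => ?_⟩
  obtain ⟨n, hn⟩ := hspec a
  dsimp only
  refine ⟨fun ha => ?_, fun b hb => ?_⟩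
  · rw [ha] at hn
    simp only [t, Option.mem_def] at hn
    split_ifs at hn with h1 h2
    · simp at hn
    · exact ⟨_, h2⟩
  · rw [hb] at hn
    simp only [t, Option.mem_def] at hn
    split_ifs at hn with h1 h2
    · simp only [Option.some.injEq] at hn
      exact hn ▸ h1
    · simp at hn

/-! ### The equations for a number-conserving relabeling -/

namespace CellularAutomaton

open Finset GroupAutomaton IntMatrix

namespace Code

/-- The base in which cells are numbered: large compared with the neighborhood. -/
def base (C : Code) : ℕ := 4 * (C.2.2.1.flatten.map Int.natAbs).sum + 1

/-- The number of cells of the cyclic group on which conservation is tested. -/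
def cells (C : Code) : ℕ := C.base ^ C.1

/-- The value in base `B` of a list of digits. -/
def baseValue (B : ℕ) (v : List ℤ) : ℤ := v.foldr (fun a z => a + B * z) 0

/-- The natural number below `M` that is congruent to `t + z`. -/
def shift (M t : ℕ) (z : ℤ) : ℕ := (t + z.toNat + (-z).toNat * (M - 1)) % M

/-- The digit number `t` of `c` in base `q`. -/
def digit (q c t : ℕ) : ℕ := c / q ^ t % q

/-- The new state of the cell `t` in the configuration whose states are the digits of `c`. -/
def nextState (C : Code) (c t : ℕ) : ℕ :=
  C.2.2.2.getD (∑ i ∈ range C.2.2.1.length,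
    digit C.2.1 c (shift C.cells t (baseValue C.base (C.2.2.1.getD i []))) * C.2.1 ^ i) 0

/-- The change in one step of the number of cells with state `s` in the configuration whose states
are the digits of `c`. -/
def defect (C : Code) (c s : ℕ) : ℤ :=
  ∑ t ∈ range C.cells,
    ((if C.nextState c t = s then 1 else 0) - if digit C.2.1 c t = s then 1 else 0)

/-- The number of configurations on the cyclic group. -/
def configs (C : Code) : ℕ := C.2.1 ^ C.cells

/-! ### Primitive recursiveness of the equations -/

lemma primrec_base : Primrec base := by
  have h : Primrec fun C : Code => (C.2.2.1.flatten.map Int.natAbs).foldr (fun a z => a + z) 0 :=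
    Primrec.list_foldr (h := fun _ r => r.1 + r.2) (Primrec.list_map (Primrec.list_flatten.comp
      (Primrec.fst.comp (Primrec.snd.comp Primrec.snd))) (Primrec.int_natAbs.comp₂ Primrec₂.right))
      (Primrec.const 0)
      (Primrec.nat_add.comp (Primrec.fst.comp Primrec.snd) (Primrec.snd.comp Primrec.snd))
  exact Primrec.succ.comp (Primrec.nat_mul.comp (Primrec.const 4) h)

lemma primrec_cells : Primrec cells := Primrec.nat_pow.comp primrec_base Primrec.fst

lemma primrec_configs : Primrec configs :=
  Primrec.nat_pow.comp (Primrec.fst.comp Primrec.snd) primrec_cells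

lemma primrec_baseValue : Primrec₂ baseValue :=
  Primrec.list_foldr (h := fun (p : ℕ × List ℤ) (r : ℤ × ℤ) => r.1 + p.1 * r.2)
    Primrec.snd (Primrec.const 0)
    (Primrec.int_add.comp (Primrec.fst.comp Primrec.snd)
      (Primrec.int_mul.comp (Primrec.int_natCast.comp (Primrec.fst.comp Primrec.fst))
        (Primrec.snd.comp Primrec.snd)))

lemma primrec_shift {α : Type*} [Primcodable α] {M t : α → ℕ} {z : α → ℤ} (hM : Primrec M)
    (ht : Primrec t) (hz : Primrec z) : Primrec fun a => shift (M a) (t a) (z a) :=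
  Primrec.nat_mod.comp
    (Primrec.nat_add.comp (Primrec.nat_add.comp ht (Primrec.int_toNat.comp hz))
      (Primrec.nat_mul.comp (Primrec.int_neg_toNat.comp hz)
        (Primrec.nat_sub.comp hM (Primrec.const 1)))) hM

lemma primrec_digit {α : Type*} [Primcodable α] {q c t : α → ℕ} (hq : Primrec q)
    (hc : Primrec c) (ht : Primrec t) : Primrec fun a => digit (q a) (c a) (t a) :=
  Primrec.nat_mod.comp (Primrec.nat_div.comp hc (Primrec.nat_pow.comp hq ht)) hq

lemma primrec_nextState {α : Type*} [Primcodable α] {C : α → Code} {c t : α → ℕ}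
    (hC : Primrec C) (hc : Primrec c) (ht : Primrec t) :
    Primrec fun a => (C a).nextState (c a) (t a) := by
  have hq : Primrec fun a => (C a).2.1 := Primrec.fst.comp (Primrec.snd.comp hC)
  have hN : Primrec fun a => (C a).2.2.1 :=
    Primrec.fst.comp (Primrec.snd.comp (Primrec.snd.comp hC))
  have hT : Primrec fun a => (C a).2.2.2 :=
    Primrec.snd.comp (Primrec.snd.comp (Primrec.snd.comp hC))
  refine Primrec.getD hT (Primrec.sum_range Primrec.nat_add (Primrec.list_length.comp hN) ?_)
  refine Primrec.nat_mul.comp (primrec_digit (hq.comp Primrec.fst) (hc.comp Primrec.fst)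
    (primrec_shift (primrec_cells.comp (hC.comp Primrec.fst)) (ht.comp Primrec.fst) ?_))
    (Primrec.nat_pow.comp (hq.comp Primrec.fst) Primrec.snd)
  exact primrec_baseValue.comp (primrec_base.comp (hC.comp Primrec.fst))
    (Primrec.getD (hN.comp Primrec.fst) Primrec.snd)

lemma primrec_indicator {α : Type*} [Primcodable α] {x y : α → ℕ} (hx : Primrec x)
    (hy : Primrec y) : Primrec fun a => if x a = y a then (1 : ℤ) else 0 :=
  Primrec.ite (Primrec.eq.comp hx hy) (Primrec.const 1) (Primrec.const 0)

lemma primrec_defect {α : Type*} [Primcodable α] {C : α → Code} {c s : α → ℕ}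
    (hC : Primrec C) (hc : Primrec c) (hs : Primrec s) :
    Primrec fun a => (C a).defect (c a) (s a) := by
  refine Primrec.sum_range Primrec.int_add (primrec_cells.comp hC) (Primrec.int_sub.comp
    (primrec_indicator (primrec_nextState (hC.comp Primrec.fst) (hc.comp Primrec.fst) Primrec.snd)
      (hs.comp Primrec.fst))
    (primrec_indicator (primrec_digit ?_ (hc.comp Primrec.fst) Primrec.snd)
      (hs.comp Primrec.fst)))
  exact Primrec.fst.comp (Primrec.snd.comp (hC.comp Primrec.fst))

/-- The list `L` solves the equations for a number-conserving relabeling. -/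
def IsSolution (C : Code) (L : List ℤ) : Prop :=
  L.length = C.2.1 ∧ IsInjectiveSolution C.configs C.2.1 C.defect fun i => L.getD i 0

/-- The list `L` shows that there is no number-conserving relabeling. -/
def IsRefutation (C : Code) (L : List ℤ) : Prop :=
  IsObstruction C.configs C.2.1 C.defect fun i => L.getD i 0

lemma primrecRel_isSolution : PrimrecRel IsSolution := by
  have hq : Primrec fun p : Code × List ℤ => p.1.2.1 :=
    Primrec.fst.comp (Primrec.snd.comp Primrec.fst)
  have hlen : PrimrecPred fun p : Code × List ℤ => p.2.length = p.1.2.1 :=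
    Primrec.eq.comp (Primrec.list_length.comp Primrec.snd) hq
  have hinj : PrimrecPred fun p : Code × List ℤ =>
      ∀ i < p.1.2.1, ∀ j < i, p.2.getD i 0 ≠ p.2.getD j 0 :=
    PrimrecPred.forall_lt' hq <| PrimrecPred.forall_lt' Primrec.snd <| PrimrecPred.not <|
      Primrec.eq.comp
        (Primrec.getD (Primrec.snd.comp (Primrec.fst.comp Primrec.fst))
          (Primrec.snd.comp Primrec.fst))
        (Primrec.getD (Primrec.snd.comp (Primrec.fst.comp Primrec.fst)) Primrec.snd)
  have hker : PrimrecPred fun p : Code × List ℤ => ∀ k < p.1.configs,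
      ∑ s ∈ range p.1.2.1, p.1.defect k s * p.2.getD s 0 = 0 :=
    PrimrecPred.forall_lt' (primrec_configs.comp Primrec.fst) <|
      Primrec.eq.comp (Primrec.sum_range Primrec.int_add (hq.comp Primrec.fst)
        (Primrec.int_mul.comp (primrec_defect (Primrec.fst.comp (Primrec.fst.comp Primrec.fst))
          (Primrec.snd.comp Primrec.fst) Primrec.snd)
          (Primrec.getD (Primrec.snd.comp (Primrec.fst.comp Primrec.fst)) Primrec.snd)))
        (Primrec.const 0)
  exact hlen.and (hinj.and hker)

lemma primrecRel_isRefutation : PrimrecRel IsRefutation := by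
  have hq : Primrec fun p : Code × List ℤ => p.1.2.1 :=
    Primrec.fst.comp (Primrec.snd.comp Primrec.fst)
  have h3 : Primrec fun x : (((Code × List ℤ) × ℕ) × ℕ) × ℕ => x.1.1.1 :=
    Primrec.fst.comp (Primrec.fst.comp Primrec.fst)
  have h0 : PrimrecPred fun p : Code × List ℤ => p.2.getD 0 0 ≠ 0 :=
    PrimrecPred.not (Primrec.eq.comp (Primrec.getD Primrec.snd (Primrec.const 0))
      (Primrec.const 0))
  have hrow : PrimrecPred fun p : Code × List ℤ => ∃ i < p.1.2.1, ∃ j < i, ∀ s < p.1.2.1,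
      ∑ k ∈ range p.1.configs, p.2.getD (k + 1) 0 * p.1.defect k s =
        p.2.getD 0 0 * ((if s = i then 1 else 0) - if s = j then 1 else 0) :=
    PrimrecPred.exists_lt' hq <| PrimrecPred.exists_lt' Primrec.snd <|
      PrimrecPred.forall_lt' (hq.comp (Primrec.fst.comp Primrec.fst)) <|
        Primrec.eq.comp
          (Primrec.sum_range Primrec.int_add (primrec_configs.comp (Primrec.fst.comp h3))
            (Primrec.int_mul.comp (Primrec.getD (Primrec.snd.comp (h3.comp Primrec.fst))
              (Primrec.succ.comp Primrec.snd))
              (primrec_defect (Primrec.fst.comp (h3.comp Primrec.fst)) Primrec.snd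
                (Primrec.snd.comp Primrec.fst))))
          (Primrec.int_mul.comp (Primrec.getD (Primrec.snd.comp h3) (Primrec.const 0))
            (Primrec.int_sub.comp
              (primrec_indicator Primrec.snd (Primrec.snd.comp (Primrec.fst.comp Primrec.fst)))
              (primrec_indicator Primrec.snd (Primrec.snd.comp Primrec.fst))))
  exact h0.and hrow

/-! ### Certificates as finite lists -/

lemma isInjectiveSolution_congr {r q : ℕ} {a : ℕ → ℕ → ℤ} {w z : ℕ → ℤ}
    (h : ∀ i < q, z i = w i) (hw : IsInjectiveSolution r q a w) :
    IsInjectiveSolution r q a z :=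
  ⟨fun i hi j hj => by rw [h i hi, h j (hj.trans hi)]; exact hw.1 i hi j hj,
    fun k hk => by
      rw [← hw.2 k hk]
      exact sum_congr rfl fun s hs => by rw [h s (mem_range.1 hs)]⟩

lemma exists_isSolution_iff (C : Code) :
    (∃ L, C.IsSolution L) ↔ ∃ w, IsInjectiveSolution C.configs C.2.1 C.defect w := by
  refine ⟨fun ⟨L, hL⟩ => ⟨_, hL.2⟩, fun ⟨w, hw⟩ => ⟨(List.range C.2.1).map w, by simp,
    isInjectiveSolution_congr (fun i hi => ?_) hw⟩⟩
  simp [hi]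

/-- The dichotomy holds for any integer matrix, so the search also halts on codes that describe no
automaton. -/
lemma exists_isSolution_or_isRefutation (C : Code) :
    (∃ L, C.IsSolution L) ∨ ∃ L, C.IsRefutation L := by
  rw [exists_isSolution_iff]
  refine (exists_isInjectiveSolution_or_isObstruction C.configs C.2.1 C.defect).imp_right ?_
  rintro ⟨w, h0, i, hi, j, hj, h⟩
  have hw : ∀ k < C.configs + 1, ((List.range (C.configs + 1)).map w).getD k 0 = w k :=
    fun k hk => by simp [hk]
  refine ⟨(List.range (C.configs + 1)).map w, ?_, i, hi, j, hj, fun s hs => ?_⟩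
  · dsimp only
    rwa [hw 0 (Nat.succ_pos _)]
  · dsimp only
    rw [hw 0 (Nat.succ_pos _), ← h s hs]
    refine sum_congr rfl fun k hk => ?_
    rw [hw (k + 1) (Nat.succ_lt_succ (mem_range.1 hk))]

lemma IsRefutation.not_isInjectiveSolution {C : Code} {L : List ℤ} (h : C.IsRefutation L)
    (w : ℕ → ℤ) : ¬ IsInjectiveSolution C.configs C.2.1 C.defect w :=
  IsObstruction.not_isInjectiveSolution h w

/-! ### Arithmetic of the encoding -/

lemma cells_pos (C : Code) : 0 < C.cells := Nat.pow_pos (Nat.succ_pos _)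

lemma baseValue_ofFn (B : ℕ) : ∀ {d : ℕ} (v : Fin d → ℤ),
    baseValue B (List.ofFn v) = ∑ j, v j * (B : ℤ) ^ (j : ℕ)
  | 0, _ => by simp [baseValue]
  | d + 1, v => by
    have ih := baseValue_ofFn B fun j => v j.succ
    rw [baseValue] at ih ⊢
    rw [List.ofFn_succ, List.foldr_cons, ih, Fin.sum_univ_succ, mul_sum]
    simp only [Fin.val_zero, pow_zero, mul_one, Fin.val_succ, pow_succ]
    congr 1
    exact sum_congr rfl fun _ _ => by ring

/-- The factor `M - 1` is `-1` modulo `M`, so the negative part of `z` is subtracted within `ℕ`. -/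
lemma shift_eq_val {M : ℕ} [NeZero M] (t : ℕ) (z : ℤ) :
    shift M t z = ((t : ZMod M) + (z : ZMod M)).val := by
  have h : ((t + z.toNat + (-z).toNat * (M - 1) : ℕ) : ZMod M) = t + z := by
    have hz : (z : ZMod M) = ((z.toNat : ℤ) - ((-z).toNat : ℤ) : ℤ) := by
      rw [Int.toNat_sub_toNat_neg]
    rw [hz]
    push_cast [Nat.cast_sub (Nat.one_le_iff_ne_zero.2 (NeZero.ne M))]
    simp
    ring
  rw [← h, ZMod.val_natCast, shift]

/-- Weighting the count of each state by `w` sums `w` over the cells; the bounds ensure that every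
state occurring is counted. -/
lemma sum_defect_mul (C : Code) {c : ℕ} (h1 : ∀ t < C.cells, C.nextState c t < C.2.1)
    (h2 : ∀ t < C.cells, digit C.2.1 c t < C.2.1) (w : ℕ → ℤ) :
    ∑ s ∈ range C.2.1, C.defect c s * w s =
      ∑ t ∈ range C.cells, (w (C.nextState c t) - w (digit C.2.1 c t)) := by
  simp only [defect, sum_mul]
  rw [sum_comm]
  refine sum_congr rfl fun t ht => ?_
  simp [sub_mul, sum_sub_distrib, h1 t (mem_range.1 ht), h2 t (mem_range.1 ht)]

end Code

/-! ### Correctness of the equations for the code of an automaton -/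

variable {d : ℕ} {S : Type*} {q m : ℕ}

lemma abs_le_of_mem_code (F : CellularAutomaton d S) (e : Fin q ≃ S) (ν : Fin m ≃ F.N)
    {n : Fin d → ℤ} (hn : n ∈ F.N) (j : Fin d) :
    |n j| ≤ ((((F.code e ν).2.2.1.flatten.map Int.natAbs).sum : ℕ) : ℤ) := by
  rw [Int.abs_eq_natAbs]
  refine Int.ofNat_le.2 (List.le_sum_of_mem (List.mem_map_of_mem (List.mem_flatten.2
    ⟨List.ofFn n, ?_, (List.mem_ofFn' _ _).2 ⟨j, rfl⟩⟩)))
  exact (List.mem_ofFn' _ _).2 ⟨ν.symm ⟨n, hn⟩, by simp⟩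

instance (C : Code) : NeZero C.base := ⟨Nat.succ_ne_zero _⟩

instance (C : Code) : NeZero C.cells := ⟨C.cells_pos.ne'⟩

/-- The remainders modulo `M`. -/
def zmodEquivFin (M : ℕ) [NeZero M] : ZMod M ≃ Fin M where
  toFun g := ⟨g.val, g.val_lt⟩
  invFun t := (t : ℕ)
  left_inv g := by simp
  right_inv t := by ext; simp [ZMod.val_cast_of_lt t.2]

/-- The configurations on `ZMod M`, numbered. -/
def configEquiv (M : ℕ) [NeZero M] (e : Fin q ≃ S) : Fin (q ^ M) ≃ (ZMod M → S) :=
  finFunctionFinEquiv.symm.trans ((zmodEquivFin M).symm.arrowCongr e)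

lemma digit_eq (M : ℕ) [NeZero M] (e : Fin q ≃ S) (k : Fin (q ^ M)) (g : ZMod M) :
    Code.digit q k g.val = e.symm (configEquiv M e k g) := by
  simp [configEquiv, Equiv.arrowCongr, zmodEquivFin, Code.digit]

/-- The cells of `ℤ ^ d`, numbered as in the test of conservation. -/
def toCells (F : CellularAutomaton d S) (e : Fin q ≃ S) (ν : Fin m ≃ F.N) :
    (Fin d → ℤ) →+ ZMod (F.code e ν).cells :=
  toCyclic (F.code e ν).base

lemma nextState_eq (F : CellularAutomaton d S) (e : Fin q ≃ S) (ν : Fin m ≃ F.N)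
    (k : Fin (q ^ (F.code e ν).cells)) (g : ZMod (F.code e ν).cells) :
    (F.code e ν).nextState k g.val =
      e.symm (F.f fun n => configEquiv _ e k (g + toCells F e ν n)) := by
  let w : Fin m → Fin q := fun i => e.symm (configEquiv _ e k (g + toCells F e ν (ν i).1))
  have hlen : (F.code e ν).2.2.1.length = m := by simp [code]
  -- The table index computed from the digits is the number of the neighborhood pattern `w`, so the
  -- default values of `getD` are never used.
  have hidx : ∑ i ∈ range (F.code e ν).2.2.1.length, Code.digit (F.code e ν).2.1 k
      (Code.shift (F.code e ν).cells g.val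
        (Code.baseValue (F.code e ν).base ((F.code e ν).2.2.1.getD i []))) *
          (F.code e ν).2.1 ^ i =
      finFunctionFinEquiv w := by
    rw [hlen, sum_range, finFunctionFinEquiv_apply]
    refine sum_congr rfl fun i _ => ?_
    have hi : (F.code e ν).2.2.1.getD i [] = List.ofFn (ν i).1 := by simp [code]
    rw [hi, Code.shift_eq_val, Code.baseValue_ofFn, ZMod.natCast_val, ZMod.cast_id]
    congr 1
    exact digit_eq _ e k (g + toCells F e ν (ν i).1)
  rw [Code.nextState, hidx]
  have hT : ∀ l : Fin (q ^ m), (F.code e ν).2.2.2.getD l 0 =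
      (e.symm (F.f fun n => e (finFunctionFinEquiv.symm l (ν.symm n))) : Fin q) := by
    intro l
    simp [code]
  rw [hT]
  simp [w]

/-- The numbers below `q ^ M` list all configurations on `ZMod M`, where `M` is the number of cells;
each gives one row of the system. -/
lemma conserves_iff_code (F : CellularAutomaton d S) (e : Fin q ≃ S) (ν : Fin m ≃ F.N)
    (w : ℕ → ℤ) :
    Conserves F.N F.f (fun s => w (e.symm s)) (toCells F e ν) ↔
      ∀ k < (F.code e ν).configs,
        ∑ s ∈ range (F.code e ν).2.1, (F.code e ν).defect k s * w s = 0 := by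
  have key : ∀ k : Fin (q ^ (F.code e ν).cells),
      ∑ s ∈ range (F.code e ν).2.1, (F.code e ν).defect k s * w s =
      ∑ g : ZMod (F.code e ν).cells,
        (w (e.symm (F.f fun n => configEquiv _ e k (g + toCells F e ν n))) -
        w (e.symm (configEquiv _ e k g))) := by
    intro k
    have hval : ∀ t < (F.code e ν).cells, ((t : ZMod (F.code e ν).cells)).val = t :=
      fun t ht => ZMod.val_cast_of_lt ht
    rw [Code.sum_defect_mul, sum_range]
    · refine Fintype.sum_equiv (zmodEquivFin _).symm _ _ fun t => ?_
      have ht : (((zmodEquivFin (F.code e ν).cells).symm t).val) = t := hval t t.2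
      rw [← nextState_eq, ← digit_eq, ht]
      rfl
    · intro t ht
      rw [← hval t ht, nextState_eq F e ν k]
      exact Fin.is_lt _
    · intro t ht
      rw [← hval t ht]
      exact (digit_eq _ e k _).trans_lt (Fin.is_lt _)
  constructor
  · intro h k hk
    rw [key ⟨k, hk⟩, sum_sub_distrib, sub_eq_zero]
    exact h _
  · intro h x
    have := h ((configEquiv (F.code e ν).cells e).symm x) (Fin.is_lt _)
    rw [key, sum_sub_distrib, sub_eq_zero, Equiv.apply_symm_apply] at this
    exact this

lemma numberConserving_iff_code (F : CellularAutomaton d S) (e : Fin q ≃ S) (ν : Fin m ≃ F.N)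
    (φ : S → ℤ) (hφ : Function.Injective φ) (w : ℕ → ℤ) (hw : ∀ i, w (i : Fin q) = φ (e i)) :
    (F.relabel φ hφ).NumberConserving ↔ ∀ k < (F.code e ν).configs,
        ∑ s ∈ range (F.code e ν).2.1, (F.code e ν).defect k s * w s = 0 := by
  rw [← conserves_iff_code, numberConserving_iff_conserves_toCyclic F φ hφ
    (Int.natCast_nonneg _) (fun n hn j => abs_le_of_mem_code F e ν hn j)
    (B := (F.code e ν).base) (by rw [Code.base]; push_cast; linarith)]
  simp only [hw, Equiv.apply_symm_apply]
  rfl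

/-- The solutions of the equations are the injective number-conserving relabelings. -/
lemma exists_relabel_of_isSolution (F : CellularAutomaton d S) (e : Fin q ≃ S)
    (ν : Fin m ≃ F.N) {L : List ℤ} (hL : (F.code e ν).IsSolution L) :
    ∃ (φ : S → ℤ) (hφ : Function.Injective φ),
      (F.relabel φ hφ).NumberConserving ∧ L = List.ofFn (fun i : Fin q => φ (e i)) := by
  obtain ⟨hlen, hinj, hker⟩ := hL
  have hlen : L.length = q := hlen
  refine ⟨fun s => L.getD (e.symm s) 0, fun s t hst => ?_, ?_, ?_⟩
  · rcases lt_trichotomy (e.symm s) (e.symm t) with h | h | h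
    · exact absurd hst.symm (hinj _ (e.symm t).2 _ h)
    · exact e.symm.injective h
    · exact absurd hst (hinj _ (e.symm s).2 _ h)
  · exact (numberConserving_iff_code F e ν _ _ (fun i => L.getD i 0) (by simp)).2 hker
  · refine List.ext_getElem (by simp [hlen]) fun i h1 h2 => ?_
    simp [h1]

lemma exists_isSolution_of_relabel (F : CellularAutomaton d S) (e : Fin q ≃ S)
    (ν : Fin m ≃ F.N) {φ : S → ℤ} {hφ : Function.Injective φ}
    (h : (F.relabel φ hφ).NumberConserving) :
    ∃ w, IsInjectiveSolution (F.code e ν).configs (F.code e ν).2.1 (F.code e ν).defect w := by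
  let w : ℕ → ℤ := fun i => if hi : i < q then φ (e ⟨i, hi⟩) else 0
  refine ⟨w, fun i hi j hj hij => ?_, (numberConserving_iff_code F e ν φ hφ w ?_).1 h⟩
  · have hi : i < q := hi
    simp only [w, hi, hj.trans hi, dif_pos] at hij
    exact hj.ne' (Fin.mk.inj (e.injective (hφ hij)))
  · simp [w]

end CellularAutomaton

theorem mainTheorem3 :
    ∃ alg : CellularAutomaton.Code → Option (List ℤ), Computable alg ∧
      ∀ (d : ℕ) (S : Type*) (F : CellularAutomaton d S) (q m : ℕ)
        (e : Fin q ≃ S) (ν : Fin m ≃ F.N),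
        ((alg (F.code e ν)).isSome = true ↔
          ∃ (φ : S → ℤ) (hφ : Function.Injective φ), (F.relabel φ hφ).NumberConserving) ∧
        ∀ L : List ℤ, alg (F.code e ν) = some L →
          ∃ (φ : S → ℤ) (hφ : Function.Injective φ),
            (F.relabel φ hφ).NumberConserving ∧ L = List.ofFn (fun i : Fin q => φ (e i)) := by
  obtain ⟨alg, halg, hspec⟩ := exists_computable_search
    CellularAutomaton.Code.primrecRel_isSolution CellularAutomaton.Code.primrecRel_isRefutation
    CellularAutomaton.Code.exists_isSolution_or_isRefutation
  refine ⟨alg, halg, fun d S F q m e ν => ?_⟩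
  have hsol : ∀ L : List ℤ, alg (F.code e ν) = some L →
      ∃ (φ : S → ℤ) (hφ : Function.Injective φ),
        (F.relabel φ hφ).NumberConserving ∧ L = List.ofFn (fun i : Fin q => φ (e i)) :=
    fun L hL => F.exists_relabel_of_isSolution e ν ((hspec _).2 L hL)
  refine ⟨⟨fun h => ?_, fun ⟨φ, hφ, h⟩ => ?_⟩, hsol⟩
  · obtain ⟨L, hL⟩ := Option.isSome_iff_exists.1 h
    obtain ⟨φ, hφ, h, _⟩ := hsol L hL
    exact ⟨φ, hφ, h⟩
  · by_contra hnone
    -- The answer `none` comes with a refutation, which excludes the solution given by `φ`.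
    obtain ⟨L, hL⟩ := (hspec _).1 (Option.not_isSome_iff_eq_none.1 hnone)
    obtain ⟨w, hw⟩ := F.exists_isSolution_of_relabel e ν h
    exact hL.not_isInjectiveSolution w hw
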